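/- Let $X_1$ and $X_2$ be locally compact Hausdorff spaces and, for $i=1,2$, let $\eta_i : X_i \to X_i$ be a proper continuous map. For a locally compact Hausdorff space $X$ with a proper continuous map $\eta : X \to X$, the semicrossed product $C_0(X)\times_\eta \mathbb{Z}^+$ is defined as follows. For $x \in X$ let $H_x = \ell^2(\mathbb{N})$ be the Hilbert space of square summable complex sequences $\xi = (\xi_n)_{n\ge 0}$, and let \[ \pi_x(f)\xi = \big(f(x)\xi_0,\ f(\eta(x))\xi_1,\ f(\eta^{(2)}(x))\xi_2,\ \dots\big)\quad (f \in C_0(X)),\qquad U_x\xi = (0,\xi_0,\xi_1,\xi_2,\dots), \] where $\eta^{(n)}$ is the $n$-th iterate of $\eta$ and $C_0(X)$ is the algebra of continuous complex-valued functions on $X$ vanishing at infinity. Then $C_0(X)\times_\eta\mathbb{Z}^+$ is the norm closed (not necessarily unital) complex algebra of operators on $\bigoplus_{x\in X} H_x$ (Hilbert space direct sum) generated by all the operators \[ \bigoplus_{x\in X}\pi_x(f), \qquad \bigoplus_{x \in X} U_x\pi_x(g), \qquad f, g \in C_0(X). \] Then the dynamical systems $(X_1,\eta_1)$ and $(X_2,\eta_2)$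 are conjugate, i.e. there is a homeomorphism $h : X_1\to X_2$ with $h\circ\eta_1 = \eta_2\circ h$, if and only if $C_0(X_1)\times_{\eta_1}\mathbb{Z}^+$ and $C_0(X_2)\times_{\eta_2}\mathbb{Z}^+$ are isomorphic as algebras, i.e. there is a bijective, complex-linear, multiplicative map (not assumed continuous) between them. -/

import Mathlib

open scoped ENNReal ZeroAtInfty

noncomputable section

namespace Semicrossed

/-- The Hilbert space `ℓ²(ℕ)` of square summable complex sequences. -/
abbrev L2N : Type := lp (fun _ : ℕ => ℂ) 2

/-- The Hilbert space direct sum `⨁_{x ∈ X} ℓ²(ℕ)`. -/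
abbrev HilbertSum (X : Type*) : Type _ := lp (fun _ : X => L2N) 2

/-- The sequence `(0, ξ₀, ξ₁, ξ₂, …)`. -/
def shiftSeq (ξ : ℕ → ℂ) : ℕ → ℂ
  | 0 => 0
  | n + 1 => ξ n

theorem hasSum_shiftSeq (ξ : L2N) :
    HasSum (fun n => ‖shiftSeq ξ n‖ ^ (2 : ℝ≥0∞).toReal) (‖ξ‖ ^ (2 : ℝ≥0∞).toReal) := by
  have h := lp.hasSum_norm (p := 2) (by norm_num) ξ
  rw [← hasSum_nat_add_iff' 1]
  simpa [shiftSeq] using h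

/-- The forward shift `(ξ₀, ξ₁, …) ↦ (0, ξ₀, ξ₁, …)` on `ℓ²(ℕ)`. -/
def shift : L2N →ₗᵢ[ℂ] L2N where
  toFun ξ := ⟨shiftSeq ξ, memℓp_gen (hasSum_shiftSeq ξ).summable⟩
  map_add' ξ ζ := by
    ext n
    change shiftSeq (⇑ξ + ⇑ζ) n = shiftSeq ξ n + shiftSeq ζ n
    cases n <;> simp [shiftSeq]
  map_smul' c ξ := by
    ext n
    cases n <;> simp [shiftSeq]
  norm_map' ξ := by
    have h := (hasSum_shiftSeq ξ).tsum_eq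
    have h2 := lp.norm_rpow_eq_tsum (p := 2) (by norm_num)
      (⟨shiftSeq ξ, memℓp_gen (hasSum_shiftSeq ξ).summable⟩ : L2N)
    have h3 := h2.trans h
    simpa using h3

variable {X : Type*} [TopologicalSpace X]

theorem norm_apply_smul_id_le (f : C₀(X, ℂ)) (y : X) :
    ‖f y • ContinuousLinearMap.id ℂ ℂ‖ ≤ ‖f‖ := by
  rw [norm_smul, ContinuousLinearMap.norm_id, mul_one, ← ZeroAtInftyContinuousMap.norm_toBCF_eq_norm]
  exact f.toBCF.norm_coe_le_norm y

/-- `π_x(f) (ξ₀, ξ₁, ξ₂, …) = (f(x) ξ₀, f(η(x)) ξ₁, f(η(η(x))) ξ₂, …)`, the diagonal operator on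
`ℓ²(ℕ)` with entries `f (η^[n] x)`. -/
def rep (η : X → X) (f : C₀(X, ℂ)) (x : X) : L2N →L[ℂ] L2N :=
  lp.mapCLM 2 (fun n : ℕ => f (η^[n] x) • ContinuousLinearMap.id ℂ ℂ) (norm_nonneg f)
    (fun n => norm_apply_smul_id_le f (η^[n] x))

theorem norm_rep_le (η : X → X) (f : C₀(X, ℂ)) (x : X) : ‖rep η f x‖ ≤ ‖f‖ :=
  lp.norm_mapCLM_le 2 _ (norm_nonneg f) _

/-- `U_x π_x(g)` with `U_x` the forward shift. -/
def shiftRep (η : X → X) (g : C₀(X, ℂ)) (x : X) : L2N →L[ℂ] L2N :=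
  shift.toContinuousLinearMap ∘L rep η g x

theorem norm_shiftRep_le (η : X → X) (g : C₀(X, ℂ)) (x : X) : ‖shiftRep η g x‖ ≤ ‖g‖ := by
  refine ContinuousLinearMap.opNorm_le_bound _ (norm_nonneg g) fun ξ => ?_
  have h : ‖shiftRep η g x ξ‖ = ‖rep η g x ξ‖ := shift.norm_map _
  rw [h]
  exact (rep η g x).le_of_opNorm_le (norm_rep_le η g x) ξ

/-- `⨁_{x ∈ X} π_x(f)`. -/
def sumRep (η : X → X) (f : C₀(X, ℂ)) : HilbertSum X →L[ℂ] HilbertSum X :=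
  lp.mapCLM 2 (rep η f) (norm_nonneg f) (norm_rep_le η f)

/-- `⨁_{x ∈ X} U_x π_x(g)`. -/
def sumShiftRep (η : X → X) (g : C₀(X, ℂ)) : HilbertSum X →L[ℂ] HilbertSum X :=
  lp.mapCLM 2 (shiftRep η g) (norm_nonneg g) (norm_shiftRep_le η g)

/-- Peters' semicrossed product `C₀(X) ×_η ℤ⁺`: the norm closed (not necessarily unital) complex
algebra of operators on `⨁_{x ∈ X} ℓ²(ℕ)` generated by all `⨁ π_x(f)` and `⨁ U_x π_x(g)`. -/
def semicrossedProduct (η : X → X) :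
    NonUnitalSubalgebra ℂ (HilbertSum X →L[ℂ] HilbertSum X) :=
  (NonUnitalAlgebra.adjoin ℂ
    (Set.range (sumRep η) ∪ Set.range (sumShiftRep η))).topologicalClosure

/-- The systems `(X, η)` and `(Y, θ)` are conjugate: some homeomorphism intertwines the maps. -/
def Conjugate {X Y : Type*} [TopologicalSpace X] [TopologicalSpace Y] (η : X → X) (θ : Y → Y) :
    Prop :=
  ∃ h : X ≃ₜ Y, ∀ x, h (η x) = θ (h x)

/-- Two possibly non-unital complex algebras are isomorphic as algebras: there is a bijective,
complex-linear and multiplicative map (no continuity is required). -/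
def IsomorphicAsAlgebras (A B : Type*) [NonUnitalRing A] [Module ℂ A] [NonUnitalRing B]
    [Module ℂ B] : Prop :=
  ∃ φ : A →ₙₐ[ℂ] B, Function.Bijective φ

end Semicrossed

end

/-!
A character of the semicrossed product is automatically continuous and is determined by coordinates
`(x, w)` with `‖w‖ ≤ 1`, where `w ≠ 0` forces `η x = x`. An isomorphism permutes the characters. By
the maximum modulus principle it takes the open disc of characters over a fixed point into a disc
over a single fixed point, so it induces a homeomorphism of the base spaces. This homeomorphism
intertwines the dynamics because, for points `p ≠ q`, the relation `q = η p` says that some point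
derivation over characters with base points `q` and `p` is not inner. No continuity of the
derivation is needed: a product `k a` with `k` in `C₀(X)` factors exactly as `f + U (k ∘ η) b`, so a
derivation which vanishes on the generators vanishes identically.
-/

noncomputable section

namespace Semicrossed

open Filter Topology

section QuasiInverse

theorem apply_ne_one_of_eq_add_mul {F R S : Type*} [NonUnitalNonAssocSemiring R]
    [NonAssocRing S] [Nontrivial S] [FunLike F R S] [NonUnitalRingHomClass F R S] (χ : F) {u v : R}
    (huv : v = u + u * v) : χ u ≠ 1 := fun hu => by
  have h := congrArg χ huv
  rw [map_add, map_mul, hu, one_mul] at h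
  exact one_ne_zero (right_eq_add.1 h)

theorem exists_eq_add_mul_of_norm_lt_one {A : Type*} [NonUnitalNormedRing A] [CompleteSpace A]
    {u : A} (hu : ‖u‖ < 1) : ∃ v, v = u + u * v := by
  have hcontr : ContractingWith ‖u‖₊ fun v => u + u * v :=
    ⟨hu, LipschitzWith.of_dist_le_mul fun v w => by
      rw [dist_add_left, dist_eq_norm, dist_eq_norm, ← mul_sub]
      exact norm_mul_le u (v - w)⟩
  exact ⟨_, hcontr.fixedPoint_isFixedPt.symm⟩

theorem norm_character_apply_le {𝕜 A : Type*} [NormedField 𝕜] [NonUnitalNormedRing A]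
    [CompleteSpace A] [NormedSpace 𝕜 A] (χ : A →ₙₐ[𝕜] 𝕜) (a : A) : ‖χ a‖ ≤ ‖a‖ := by
  by_contra! hlt
  have hpos : 0 < ‖χ a‖ := (norm_nonneg a).trans_lt hlt
  have hnorm : ‖(χ a)⁻¹ • a‖ < 1 := by
    rwa [norm_smul, norm_inv, inv_mul_lt_one₀ hpos]
  obtain ⟨v, hv⟩ := exists_eq_add_mul_of_norm_lt_one hnorm
  refine apply_ne_one_of_eq_add_mul χ hv ?_
  rw [map_smul, smul_eq_mul, inv_mul_cancel₀ (norm_pos_iff.1 hpos)]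

theorem continuous_character {𝕜 A : Type*} [NormedField 𝕜] [NonUnitalNormedRing A]
    [CompleteSpace A] [NormedSpace 𝕜 A] (χ : A →ₙₐ[𝕜] 𝕜) : Continuous χ :=
  AddMonoidHomClass.continuous_of_bound χ 1 fun a => by
    simpa only [one_mul] using norm_character_apply_le χ a

end QuasiInverse

section ZeroAtInfty

variable {X : Type*} [TopologicalSpace X]

theorem norm_zeroAtInfty_apply_le {E : Type*} [SeminormedAddCommGroup E] (f : C₀(X, E)) (x : X) :
    ‖f x‖ ≤ ‖f‖ :=
  f.toBCF.norm_coe_le_norm x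

theorem norm_zeroAtInfty_le {E : Type*} [SeminormedAddCommGroup E] {f : C₀(X, E)} {C : ℝ}
    (hC : 0 ≤ C) (h : ∀ x, ‖f x‖ ≤ C) : ‖f‖ ≤ C :=
  (BoundedContinuousFunction.norm_le (f := f.toBCF) hC).2 h

theorem isCompact_preimage_singleton_of_ne_zero {E : Type*} [TopologicalSpace E] [T1Space E]
    [Zero E] (f : C₀(X, E)) {c : E} (hc : c ≠ 0) : IsCompact (f ⁻¹' {c}) := by
  obtain ⟨K, hK, hKf⟩ := mem_cocompact.1 (f.zero_at_infty' (isOpen_ne.mem_nhds hc.symm))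
  refine hK.of_isClosed_subset (isClosed_singleton.preimage f.continuous) fun x hx => ?_
  by_contra hxK
  exact hKf hxK hx

theorem exists_zeroAtInfty_eq_add_mul {𝕜 : Type*} [NormedField 𝕜] (u : C₀(X, 𝕜))
    (hu : ∀ x, u x ≠ 1) : ∃ v, v = u + u * v := by
  have hne : ∀ x, 1 - u x ≠ 0 := fun x => sub_ne_zero.2 (hu x).symm
  have hlim : Tendsto (fun x => u x / (1 - u x)) (cocompact X) (𝓝 0) := by
    have h := u.zero_at_infty'.div (u.zero_at_infty'.const_sub 1) (by simp)
    rwa [zero_div] at h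
  let v : C₀(X, 𝕜) :=
    ⟨⟨fun x => u x / (1 - u x), u.continuous.div (continuous_const.sub u.continuous) hne⟩, hlim⟩
  refine ⟨v, ZeroAtInftyContinuousMap.ext fun x => ?_⟩
  change u x / (1 - u x) = u x + u x * (u x / (1 - u x))
  field [hne x]

section RCLike

variable {𝕜 : Type*} [RCLike 𝕜]

theorem exists_norm_sub_mul_self_le (g : C₀(X, 𝕜)) {δ : ℝ} (hδ : 0 < δ) :
    ∃ k : C₀(X, 𝕜), ‖g - k * g‖ ≤ δ := by
  let u : C₀(X, 𝕜) := -((δ ^ 2 : ℝ)⁻¹ : 𝕜) • (star g * g)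
  have hu : ∀ x, 1 - u x = ((1 + ‖g x‖ ^ 2 / δ ^ 2 : ℝ) : 𝕜) := fun x => by
    have hux : u x = -((δ ^ 2 : ℝ)⁻¹ : 𝕜) * (star (g x) * g x) := rfl
    rw [hux, RCLike.star_def, RCLike.conj_mul]
    push_cast
    ring
  have hpos : ∀ x, 0 < 1 + ‖g x‖ ^ 2 / δ ^ 2 := fun x => by positivity
  obtain ⟨v, hv⟩ := exists_zeroAtInfty_eq_add_mul u fun x hx => by
    have h := hu x
    rw [hx, sub_self] at h
    exact (hpos x).ne (by exact_mod_cast h)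
  refine ⟨-v, norm_zeroAtInfty_le hδ.le fun x => ?_⟩
  have hmul : (g - -v * g) x * ((1 + ‖g x‖ ^ 2 / δ ^ 2 : ℝ) : 𝕜) = g x := by
    have hvx : v x = u x + u x * v x := DFunLike.congr_fun hv x
    rw [← hu]
    simp only [ZeroAtInftyContinuousMap.sub_apply, ZeroAtInftyContinuousMap.mul_apply,
      ZeroAtInftyContinuousMap.neg_apply]
    linear_combination g x * hvx
  have hnorm : ‖(g - -v * g) x‖ * (1 + ‖g x‖ ^ 2 / δ ^ 2) = ‖g x‖ := by
    simpa only [norm_mul, RCLike.norm_ofReal, abs_of_pos (hpos x)] using congrArg norm hmul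
  have hle : ‖g x‖ ≤ δ * (1 + ‖g x‖ ^ 2 / δ ^ 2) := by
    field_simp
    nlinarith [sq_nonneg (‖g x‖ - δ), norm_nonneg (g x)]
  exact le_of_mul_le_mul_right (hnorm.trans_le hle) (hpos x)

/- If `f` and the `g i` have no such common point, then `1 - u = |1 - f|² + ∑ |g i|²` vanishes
nowhere, so `u` is quasi-invertible, although `χ u = 1`. -/
theorem exists_apply_eq_one_of_character (χ : C₀(X, 𝕜) →ₙₐ[𝕜] 𝕜) {f : C₀(X, 𝕜)} (hf : χ f = 1)
    {ι : Type*} (s : Finset ι) {g : ι → C₀(X, 𝕜)} (hg : ∀ i ∈ s, χ (g i) = 0) :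
    ∃ x, f x = 1 ∧ ∀ i ∈ s, g i x = 0 := by
  let u : C₀(X, 𝕜) := f + star f - f * star f - ∑ i ∈ s, star (g i) * g i
  have hχu : χ u = 1 := by
    have hsum : ∑ i ∈ s, χ (star (g i)) * χ (g i) = 0 :=
      Finset.sum_eq_zero fun i hi => by rw [hg i hi, mul_zero]
    simp [u, hf, hsum]
  obtain ⟨x, hx⟩ : ∃ x, u x = 1 := by
    by_contra! hu
    obtain ⟨v, hv⟩ := exists_zeroAtInfty_eq_add_mul u hu
    exact apply_ne_one_of_eq_add_mul χ hv hχu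
  have hux : 1 - u x = ((‖1 - f x‖ ^ 2 + ∑ i ∈ s, ‖g i x‖ ^ 2 : ℝ) : 𝕜) := by
    have hsum : (∑ i ∈ s, star (g i) * g i) x = ∑ i ∈ s, star (g i x) * g i x :=
      map_sum (⟨⟨(· x), rfl⟩, fun _ _ => rfl⟩ : C₀(X, 𝕜) →+ 𝕜) _ s
    have hval : u x = f x + star (f x) - f x * star (f x) - ∑ i ∈ s, star (g i x) * g i x :=
      congrArg (f x + star (f x) - f x * star (f x) - ·) hsum
    push_cast
    simp only [hval, RCLike.star_def, ← RCLike.conj_mul, map_sub, map_one]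
    ring
  have hzero : ‖1 - f x‖ ^ 2 + ∑ i ∈ s, ‖g i x‖ ^ 2 = 0 := by
    rw [hx, sub_self] at hux
    exact_mod_cast hux.symm
  have hnonneg : ∀ i ∈ s, 0 ≤ ‖g i x‖ ^ 2 := fun i _ => by positivity
  obtain ⟨hfx, hgx⟩ := (add_eq_zero_iff_of_nonneg (by positivity)
    (Finset.sum_nonneg hnonneg)).1 hzero
  refine ⟨x, ?_, fun i hi => ?_⟩
  · exact (sub_eq_zero.1 (norm_eq_zero.1 (pow_eq_zero_iff two_ne_zero |>.1 hfx))).symm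
  · simpa using (Finset.sum_eq_zero_iff_of_nonneg hnonneg).1 hgx i hi

theorem exists_eq_eval_of_character {χ : C₀(X, 𝕜) →ₙₐ[𝕜] 𝕜} (hχ : χ ≠ 0) :
    ∃ x, ∀ f, χ f = f x := by
  obtain ⟨f, hf⟩ : ∃ f, χ f = 1 := by
    obtain ⟨f, hf⟩ := DFunLike.ne_iff.1 hχ
    exact ⟨(χ f)⁻¹ • f, by rw [map_smul, smul_eq_mul, inv_mul_cancel₀ hf]⟩
  have hcompact := isCompact_preimage_singleton_of_ne_zero f one_ne_zero
  obtain ⟨x, hfx, hx⟩ := hcompact.inter_iInter_nonempty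
    (fun g : {g : C₀(X, 𝕜) // χ g = 0} => (g : C₀(X, 𝕜)) ⁻¹' {0})
    (fun g => isClosed_singleton.preimage g.1.continuous) fun s => by
      obtain ⟨x, hfx, hx⟩ := exists_apply_eq_one_of_character χ hf s
        (g := Subtype.val) fun g _ => g.2
      exact ⟨x, hfx, Set.mem_iInter₂.2 hx⟩
  refine ⟨x, fun h => ?_⟩
  have hker : χ (h - χ h • f) = 0 := by simp [hf]
  have hfx : f x = 1 := hfx
  have hval : (h - χ h • f) x = 0 := Set.mem_iInter.1 hx ⟨_, hker⟩
  have heq : h x - χ h * f x = 0 := hval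
  rw [hfx, mul_one, sub_eq_zero] at heq
  exact heq.symm

end RCLike

section LocallyCompact

variable [LocallyCompactSpace X] (𝕜 : Type*) [RCLike 𝕜]

theorem exists_zeroAtInfty_eq_one [R1Space X] {x : X} {V : Set X} (hV : IsOpen V) (hx : x ∈ V) :
    ∃ f : C₀(X, 𝕜), f x = 1 ∧ (∀ y ∉ V, f y = 0) ∧ ‖f‖ ≤ 1 := by
  obtain ⟨f, hfx, hfc, hfV, hf⟩ := exists_continuousMap_one_of_isCompact_subset_isOpen
    isCompact_singleton hV (Set.singleton_subset_iff.2 hx)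
  have hlim : HasCompactSupport fun y => (f y : 𝕜) :=
    HasCompactSupport.comp_left (g := ((↑) : ℝ → 𝕜)) hfc RCLike.ofReal_zero
  have hval : ∀ {y : X} {r : ℝ}, f y = r → (f y : 𝕜) = r := congrArg _
  refine ⟨⟨⟨fun y => f y, by fun_prop⟩, hlim.is_zero_at_infty⟩, ?_, fun y hy => ?_,
    norm_zeroAtInfty_le zero_le_one fun y => ?_⟩
  · exact (hval (hfx rfl)).trans RCLike.ofReal_one
  · exact (hval (image_eq_zero_of_notMem_tsupport fun h => hy (hfV h))).trans RCLike.ofReal_zero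
  · exact RCLike.norm_ofReal (K := 𝕜) (f y) |>.trans_le
      (abs_le.2 ⟨by linarith [(hf y).1], (hf y).2⟩)

theorem exists_zeroAtInfty_apply_eq_one [R1Space X] (x : X) :
    ∃ f : C₀(X, 𝕜), f x = 1 ∧ ‖f‖ ≤ 1 := by
  obtain ⟨f, hfx, -, hf⟩ := exists_zeroAtInfty_eq_one 𝕜 isOpen_univ (Set.mem_univ x)
  exact ⟨f, hfx, hf⟩

theorem exists_zeroAtInfty_separating [T2Space X] {x y : X} (hxy : x ≠ y) :
    ∃ f : C₀(X, 𝕜), f x = 1 ∧ f y = 0 ∧ ‖f‖ ≤ 1 := by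
  obtain ⟨f, hfx, hf0, hf⟩ := exists_zeroAtInfty_eq_one 𝕜 (isOpen_ne (x := y)) hxy
  exact ⟨f, hfx, hf0 y (· rfl), hf⟩

variable {𝕜}

theorem eq_of_zeroAtInfty_apply_eq [T2Space X] {x y : X} (h : ∀ f : C₀(X, 𝕜), f x = f y) :
    x = y := by
  by_contra hxy
  obtain ⟨f, hfx, hfy, -⟩ := exists_zeroAtInfty_separating 𝕜 hxy
  exact one_ne_zero (hfx.symm.trans ((h f).trans hfy))

theorem continuous_of_zeroAtInfty_comp [R1Space X] {Y : Type*} [TopologicalSpace Y] {h : Y → X}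
    (hc : ∀ f : C₀(X, 𝕜), Continuous fun y => f (h y)) : Continuous h := by
  refine continuous_iff_continuousAt.2 fun y U hU => ?_
  obtain ⟨V, hVU, hV, hy⟩ := mem_nhds_iff.1 hU
  obtain ⟨f, hfy, hf0, -⟩ := exists_zeroAtInfty_eq_one 𝕜 hV hy
  have hne : ∀ᶠ z in 𝓝 y, f (h z) ≠ 0 :=
    (hc f).continuousAt.eventually_ne (hfy.trans_ne one_ne_zero)
  exact hne.mono fun z hz => hVU (not_imp_comm.1 (hf0 (h z)) hz)

end LocallyCompact

end ZeroAtInfty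

section HilbertSum

theorem norm_lp_eq_of_equiv {ι κ : Type*} {E : ι → Type*} {F : κ → Type*}
    [∀ i, NormedAddCommGroup (E i)] [∀ k, NormedAddCommGroup (F k)] {p : ℝ≥0∞}
    (hp : 0 < p.toReal) (e : ι ≃ κ) {ξ : lp E p} {ζ : lp F p} (h : ∀ i, ‖ξ i‖ = ‖ζ (e i)‖) :
    ‖ξ‖ = ‖ζ‖ := by
  rw [lp.norm_eq_tsum_rpow hp, lp.norm_eq_tsum_rpow hp, ← e.tsum_eq]
  simp only [h]

/-- The bounded operators on `⨁_{x ∈ X} ℓ²(ℕ)`. -/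
abbrev HilbertOp (X : Type*) : Type _ := HilbertSum X →L[ℂ] HilbertSum X

variable {X : Type*}

theorem hilbertOp_ext {S T : HilbertOp X} (h : ∀ ξ x n, S ξ x n = T ξ x n) : S = T :=
  ContinuousLinearMap.ext fun ξ => lp.ext <| funext fun x => lp.ext <| funext fun n => h ξ x n

theorem norm_apply_apply_le (ξ : HilbertSum X) (x : X) (n : ℕ) : ‖ξ x n‖ ≤ ‖ξ‖ :=
  (lp.norm_apply_le_norm two_ne_zero (ξ x) n).trans (lp.norm_apply_le_norm two_ne_zero ξ x)

/-- The direct sum `U` of the forward shifts, so that the second family of generators of the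
semicrossed product consists of the operators `U ⨁ π_x(g)`. -/
def sumShift : HilbertOp X :=
  lp.mapCLM 2 (fun _ => shift.toContinuousLinearMap) zero_le_one
    fun _ => shift.norm_toContinuousLinearMap_le

theorem sumShift_apply_zero (ξ : HilbertSum X) (x : X) : sumShift ξ x 0 = 0 := rfl

theorem norm_sumShift_apply (ξ : HilbertSum X) : ‖sumShift ξ‖ = ‖ξ‖ :=
  norm_lp_eq_of_equiv (by norm_num) (Equiv.refl X) fun x => shift.norm_map (ξ x)

theorem norm_sumShift_mul (T : HilbertOp X) : ‖sumShift * T‖ = ‖T‖ :=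
  ContinuousLinearMap.opNorm_ext _ _ fun ξ => norm_sumShift_apply (T ξ)

/-- The unit vector at position `0` of the summand indexed by `x`. -/
def vacuum (x : X) : HilbertSum X := by
  classical exact lp.single 2 x (lp.single 2 0 1)

theorem vacuum_apply_zero (x : X) : vacuum x x 0 = 1 := by
  simp [vacuum]

theorem vacuum_apply_succ (x : X) (n : ℕ) : vacuum x x (n + 1) = 0 := by
  simp [vacuum]

theorem norm_vacuum (x : X) : ‖vacuum x‖ = 1 := by
  simp [vacuum, lp.norm_single]

end HilbertSum

section Pullback

/-- Composition with a proper map, as a homomorphism between algebras of functions vanishing at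
infinity. -/
def pullback {X Y : Type*} [TopologicalSpace X] [TopologicalSpace Y] {η : X → Y}
    (hη : IsProperMap η) : C₀(Y, ℂ) →ₙₐ[ℂ] C₀(X, ℂ) :=
  ZeroAtInftyContinuousMap.compNonUnitalAlgHom ⟨⟨η, hη.continuous⟩, fun s hs => by
    obtain ⟨K, hK, h⟩ := mem_cocompact.1 hs
    exact mem_cocompact.2 ⟨η ⁻¹' K, hη.isCompact_preimage hK, fun x hx => h hx⟩⟩

theorem pullback_apply {X Y : Type*} [TopologicalSpace X] [TopologicalSpace Y] {η : X → Y}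
    (hη : IsProperMap η) (f : C₀(Y, ℂ)) (x : X) : pullback hη f x = f (η x) := rfl

end Pullback

section SemicrossedProduct

variable {X : Type*} [TopologicalSpace X] {η : X → X}

theorem sumRep_apply (η : X → X) (f : C₀(X, ℂ)) (ξ : HilbertSum X) (x : X) (n : ℕ) :
    sumRep η f ξ x n = f (η^[n] x) * ξ x n := rfl

theorem norm_sumRep_le (η : X → X) (f : C₀(X, ℂ)) : ‖sumRep η f‖ ≤ ‖f‖ :=
  lp.norm_mapCLM_le 2 _ (norm_nonneg f) _

/-- `f ↦ ⨁ π_x(f)` as a homomorphism into the bounded operators. -/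
def sumRepHom (η : X → X) : C₀(X, ℂ) →ₙₐ[ℂ] HilbertOp X where
  toFun := sumRep η
  map_smul' _ _ := hilbertOp_ext fun _ _ _ => mul_assoc _ _ _
  map_zero' := hilbertOp_ext fun _ _ _ => zero_mul _
  map_add' _ _ := hilbertOp_ext fun _ _ _ => add_mul _ _ _
  map_mul' _ _ := hilbertOp_ext fun _ _ _ => mul_assoc _ _ _

theorem sumRepHom_mul_sumShift (hη : IsProperMap η) (f : C₀(X, ℂ)) :
    sumRepHom η f * sumShift = sumShift * sumRepHom η (pullback hη f) :=
  hilbertOp_ext fun ξ x n => by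
    cases n with
    | zero => exact mul_zero _
    | succ n => exact congrArg (f · * ξ x n) (Function.iterate_succ_apply' η n x)

/-- The copy of `C₀(X)` in the semicrossed product. -/
def diagHom (η : X → X) : C₀(X, ℂ) →ₙₐ[ℂ] semicrossedProduct η :=
  NonUnitalAlgHom.codRestrict (sumRepHom η) _ fun f =>
    NonUnitalSubalgebra.le_topologicalClosure _
      (NonUnitalAlgebra.subset_adjoin ℂ (Or.inl ⟨f, rfl⟩))

/-- The generators `U g` of the semicrossed product, as a linear function of `g`. -/
def shiftHom (η : X → X) : C₀(X, ℂ) →ₗ[ℂ] semicrossedProduct η where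
  toFun g := ⟨sumShiftRep η g, NonUnitalSubalgebra.le_topologicalClosure _
    (NonUnitalAlgebra.subset_adjoin ℂ (Or.inr ⟨g, rfl⟩))⟩
  map_add' f g := Subtype.ext <| by
    change sumShift * sumRepHom η (f + g) = sumShift * sumRepHom η f + sumShift * sumRepHom η g
    rw [map_add, mul_add]
  map_smul' c g := Subtype.ext <| by
    change sumShift * sumRepHom η (c • g) = c • (sumShift * sumRepHom η g)
    rw [map_smul, mul_smul_comm]

theorem coe_diagHom (η : X → X) (f : C₀(X, ℂ)) :
    (diagHom η f : HilbertOp X) = sumRepHom η f := rfl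

theorem coe_shiftHom (η : X → X) (g : C₀(X, ℂ)) :
    (shiftHom η g : HilbertOp X) = sumShift * sumRepHom η g := rfl

theorem norm_shiftHom_le (η : X → X) (g : C₀(X, ℂ)) : ‖shiftHom η g‖ ≤ ‖g‖ :=
  lp.norm_mapCLM_le 2 _ (norm_nonneg g) (norm_shiftRep_le η g)

theorem shiftHom_mul_diagHom (η : X → X) (f g : C₀(X, ℂ)) :
    shiftHom η f * diagHom η g = shiftHom η (f * g) := Subtype.ext <| by
  change sumShift * sumRepHom η f * sumRepHom η g = sumShift * sumRepHom η (f * g)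
  rw [map_mul, mul_assoc]

theorem diagHom_mul_shiftHom (hη : IsProperMap η) (f g : C₀(X, ℂ)) :
    diagHom η f * shiftHom η g = shiftHom η g * diagHom η (pullback hη f) := by
  rw [shiftHom_mul_diagHom, mul_comm]
  refine Subtype.ext ?_
  change sumRepHom η f * (sumShift * sumRepHom η g) = sumShift * sumRepHom η (pullback hη f * g)
  rw [← mul_assoc, sumRepHom_mul_sumShift hη, mul_assoc, map_mul]

theorem isClosed_semicrossedProduct (η : X → X) :
    IsClosed (semicrossedProduct η : Set (HilbertOp X)) :=
  NonUnitalSubalgebra.isClosed_topologicalClosure _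

instance (η : X → X) : CompleteSpace (semicrossedProduct η) :=
  (isClosed_semicrossedProduct η).completeSpace_coe

instance (η : X → X) : NormedSpace ℂ (semicrossedProduct η) :=
  SubmoduleClass.toNormedSpace _

theorem semicrossedProduct_le {S : NonUnitalSubalgebra ℂ (HilbertOp X)}
    (hS : IsClosed (S : Set (HilbertOp X))) (hdiag : ∀ f, (diagHom η f : HilbertOp X) ∈ S)
    (hshift : ∀ g, (shiftHom η g : HilbertOp X) ∈ S) : semicrossedProduct η ≤ S := by
  refine NonUnitalSubalgebra.topologicalClosure_minimal (NonUnitalAlgebra.adjoin_le ?_) hS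
  rintro _ (⟨f, rfl⟩ | ⟨g, rfl⟩)
  exacts [hdiag f, hshift g]

theorem semicrossedProduct_induction {p : semicrossedProduct η → Prop}
    (hp : IsClosed {a | p a}) (hdiag : ∀ f, p (diagHom η f)) (hshift : ∀ g, p (shiftHom η g))
    (hadd : ∀ a b, p a → p b → p (a + b)) (hsmul : ∀ (c : ℂ) a, p a → p (c • a))
    (hmul : ∀ a b, p a → p b → p (a * b)) (a : semicrossedProduct η) : p a := by
  let P : NonUnitalSubalgebra ℂ (semicrossedProduct η) :=
    { carrier := {a | p a}
      zero_mem' := map_zero (diagHom η) ▸ hdiag 0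
      add_mem' := hadd _ _
      smul_mem' := fun c _ => hsmul c _
      mul_mem' := hmul _ _ }
  let S := P.map (NonUnitalSubalgebraClass.subtype (semicrossedProduct η))
  have hS : IsClosed (S : Set (HilbertOp X)) :=
    (isClosed_semicrossedProduct η).isClosedMap_subtype_val _ hp
  obtain ⟨b, hb, hba⟩ := semicrossedProduct_le (S := S) hS (fun f => ⟨_, hdiag f, rfl⟩)
    (fun g => ⟨_, hshift g, rfl⟩) a.2
  rwa [← Subtype.ext hba]

/-- The map `(f, b) ↦ f + U b`, whose range turns out to contain the semicrossed product. -/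
def diagAddShift (η : X → X) : C₀(X, ℂ) × semicrossedProduct η →ₗ[ℂ] HilbertOp X :=
  (sumRepHom η : C₀(X, ℂ) →ₗ[ℂ] HilbertOp X).coprod
    (LinearMap.mulLeft ℂ sumShift ∘ₗ SMulMemClass.subtype (semicrossedProduct η))

theorem diagAddShift_apply (f : C₀(X, ℂ)) (b : semicrossedProduct η) :
    diagAddShift η (f, b) = sumRepHom η f + sumShift * (b : HilbertOp X) := rfl

theorem diagAddShift_vacuum (q : C₀(X, ℂ) × semicrossedProduct η) (x : X) :
    diagAddShift η q (vacuum x) x 0 = q.1 x := by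
  change q.1 x * vacuum x x 0 + 0 = q.1 x
  rw [vacuum_apply_zero, mul_one, add_zero]

theorem norm_fst_le_norm_diagAddShift (q : C₀(X, ℂ) × semicrossedProduct η) :
    ‖q.1‖ ≤ ‖diagAddShift η q‖ :=
  norm_zeroAtInfty_le (norm_nonneg _) fun x => calc
    ‖q.1 x‖ ≤ ‖diagAddShift η q (vacuum x)‖ := by
      rw [← diagAddShift_vacuum]
      exact norm_apply_apply_le _ x 0
    _ ≤ ‖diagAddShift η q‖ := by
      simpa only [norm_vacuum, mul_one] using (diagAddShift η q).le_opNorm (vacuum x)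

theorem norm_snd_le_norm_diagAddShift (q : C₀(X, ℂ) × semicrossedProduct η) :
    ‖q.2‖ ≤ 2 * ‖diagAddShift η q‖ := calc
  ‖q.2‖ = ‖diagAddShift η q - sumRepHom η q.1‖ := by
    rw [← Prod.mk.eta (p := q), diagAddShift_apply, add_sub_cancel_left, norm_sumShift_mul]
    rfl
  _ ≤ ‖diagAddShift η q‖ + ‖q.1‖ :=
    (norm_sub_le _ _).trans (add_le_add_right (norm_sumRep_le η q.1) _)
  _ ≤ 2 * ‖diagAddShift η q‖ := by linarith [norm_fst_le_norm_diagAddShift q]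

theorem norm_diagAddShift_le (q : C₀(X, ℂ) × semicrossedProduct η) :
    ‖diagAddShift η q‖ ≤ 2 * ‖q‖ := calc
  ‖diagAddShift η q‖ ≤ ‖sumRep η q.1‖ + ‖sumShift * (q.2 : HilbertOp X)‖ := norm_add_le _ _
  _ ≤ ‖q‖ + ‖q‖ := add_le_add ((norm_sumRep_le η q.1).trans (norm_fst_le q))
    ((norm_sumShift_mul _).trans_le (norm_snd_le q))
  _ = 2 * ‖q‖ := (two_mul _).symm

theorem isClosed_range_diagAddShift (η : X → X) :
    IsClosed (Set.range (diagAddShift η)) := by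
  have hanti : AntilipschitzWith 2 (diagAddShift η) :=
    AddMonoidHomClass.antilipschitz_of_bound _ fun q =>
      max_le ((norm_fst_le_norm_diagAddShift q).trans
        (le_mul_of_one_le_left (norm_nonneg _) one_le_two)) (norm_snd_le_norm_diagAddShift q)
  exact hanti.isClosed_range
    (AddMonoidHomClass.uniformContinuous_of_bound _ 2 norm_diagAddShift_le)

theorem diagAddShift_mul (hη : IsProperMap η) (q r : C₀(X, ℂ) × semicrossedProduct η)
    {b : semicrossedProduct η} (hb : diagAddShift η r = b) :
    diagAddShift η q * (b : HilbertOp X) =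
      diagAddShift η (q.1 * r.1, q.2 * b + diagHom η (pullback hη q.1) * r.2) := by
  have hq : sumRepHom η q.1 * (b : HilbertOp X) = sumRepHom η (q.1 * r.1) +
      sumShift * (sumRepHom η (pullback hη q.1) * (r.2 : HilbertOp X)) := by
    rw [← hb, ← Prod.mk.eta (p := r), diagAddShift_apply, mul_add, map_mul, ← mul_assoc,
      sumRepHom_mul_sumShift hη, mul_assoc]
  change (sumRepHom η q.1 + sumShift * (q.2 : HilbertOp X)) * (b : HilbertOp X) =
    sumRepHom η (q.1 * r.1) + sumShift * ((q.2 : HilbertOp X) * (b : HilbertOp X) +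
      sumRepHom η (pullback hη q.1) * (r.2 : HilbertOp X))
  rw [add_mul, hq, mul_add, mul_assoc]
  abel

theorem exists_diagAddShift_eq (hη : IsProperMap η) (a : semicrossedProduct η) :
    ∃ q, diagAddShift η q = a := by
  induction a using semicrossedProduct_induction with
  | hp => exact (isClosed_range_diagAddShift η).preimage continuous_subtype_val
  | hdiag f => exact ⟨(f, 0), by
      rw [diagAddShift_apply, ZeroMemClass.coe_zero, mul_zero, add_zero, coe_diagHom]⟩
  | hshift g => exact ⟨(0, diagHom η g), by
      rw [diagAddShift_apply, map_zero, zero_add, coe_diagHom, coe_shiftHom]⟩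
  | hadd a b ha hb =>
    obtain ⟨q, hq⟩ := ha
    obtain ⟨r, hr⟩ := hb
    exact ⟨q + r, by rw [map_add, hq, hr]; rfl⟩
  | hsmul c a ha =>
    obtain ⟨q, hq⟩ := ha
    exact ⟨c • q, by rw [map_smul, hq]; rfl⟩
  | hmul a b ha hb =>
    obtain ⟨q, hq⟩ := ha
    obtain ⟨r, hr⟩ := hb
    exact ⟨_, by rw [← diagAddShift_mul hη q r hr, hq]; rfl⟩

theorem eq_of_apply_diagHom_eq_of_apply_shiftHom_eq {B : Type*} [NonUnitalSeminormedRing B]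
    [NormedSpace ℂ B] [T2Space B] {χ ψ : semicrossedProduct η →ₙₐ[ℂ] B} (hχ : Continuous χ)
    (hψ : Continuous ψ) (hdiag : ∀ f, χ (diagHom η f) = ψ (diagHom η f))
    (hshift : ∀ g, χ (shiftHom η g) = ψ (shiftHom η g)) : χ = ψ := by
  refine NonUnitalAlgHom.ext fun a => ?_
  induction a using semicrossedProduct_induction with
  | hp => exact isClosed_eq hχ hψ
  | hdiag f => exact hdiag f
  | hshift g => exact hshift g
  | hadd a b ha hb => rw [map_add, map_add, ha, hb]
  | hsmul c a ha => rw [map_smul, map_smul, ha]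
  | hmul a b ha hb => rw [map_mul, map_mul, ha, hb]

end SemicrossedProduct

section PointDerivations

variable {𝕜 A B : Type*} [CommRing 𝕜] [NonUnitalRing A] [Module 𝕜 A] [NonUnitalRing B] [Module 𝕜 B]

/-- `D` is a derivation into the one-dimensional bimodule on which `A` acts by the character `χ`
from the left and by `χ'` from the right. -/
def IsPointDerivation (χ χ' : A →ₙₐ[𝕜] 𝕜) (D : A →ₗ[𝕜] 𝕜) : Prop :=
  ∀ a b, D (a * b) = D a * χ' b + χ a * D b

variable {χ χ' : A →ₙₐ[𝕜] 𝕜} {D : A →ₗ[𝕜] 𝕜}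

theorem IsPointDerivation.comp (hD : IsPointDerivation χ χ' D) (φ : B →ₙₐ[𝕜] A) :
    IsPointDerivation (χ.comp φ) (χ'.comp φ) (D ∘ₗ (φ : B →ₗ[𝕜] A)) := fun a b =>
  (congrArg D (map_mul φ a b)).trans (hD (φ a) (φ b))

theorem IsPointDerivation.sub {D' : A →ₗ[𝕜] 𝕜} (hD : IsPointDerivation χ χ' D)
    (hD' : IsPointDerivation χ χ' D') : IsPointDerivation χ χ' (D - D') := fun a b => by
  rw [LinearMap.sub_apply, LinearMap.sub_apply, LinearMap.sub_apply, hD, hD']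
  ring

/-- The inner derivation `a ↦ c · a - a · c` of the bimodule belonging to `χ` and `χ'`. -/
def innerPointDerivation (χ χ' : A →ₙₐ[𝕜] 𝕜) (c : 𝕜) : A →ₗ[𝕜] 𝕜 :=
  c • ((χ' : A →ₗ[𝕜] 𝕜) - (χ : A →ₗ[𝕜] 𝕜))

theorem innerPointDerivation_apply (χ χ' : A →ₙₐ[𝕜] 𝕜) (c : 𝕜) (a : A) :
    innerPointDerivation χ χ' c a = c * (χ' a - χ a) := rfl

theorem isPointDerivation_innerPointDerivation (χ χ' : A →ₙₐ[𝕜] 𝕜) (c : 𝕜) :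
    IsPointDerivation χ χ' (innerPointDerivation χ χ' c) := fun a b => by
  simp only [innerPointDerivation_apply, map_mul]
  ring

theorem IsPointDerivation.apply_eq_of_commute (hD : IsPointDerivation χ χ' D) {a u : A}
    (hau : Commute a u) (hχ : χ u = 0) (hχ' : χ' u = 1) :
    D a = innerPointDerivation χ χ' (D u) a := by
  have h := congrArg D hau.eq
  rw [hD, hD, hχ, hχ'] at h
  rw [innerPointDerivation_apply]
  linear_combination h

end PointDerivations

section Functionals

variable {X : Type*} {z : ℂ}

/-- The functional `ξ ↦ ∑ c(n) ξ(x)(n)`. -/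
def rowFunctional (x : X) (c : L2N) : HilbertSum X →L[ℂ] ℂ :=
  innerSL ℂ (star c) ∘L lp.evalCLM ℂ (fun _ : X => L2N) 2 x

theorem hasSum_rowFunctional (x : X) (c : L2N) (ξ : HilbertSum X) :
    HasSum (fun n => c n * ξ x n) (rowFunctional x c ξ) := by
  have hterm : (fun n => c n * ξ x n) = fun n => inner ℂ (star c n) (ξ x n) := by
    funext n
    rw [lp.star_apply, RCLike.inner_apply']
    exact congrArg (· * ξ x n) (star_star (c n)).symm
  exact hterm ▸ lp.hasSum_inner (𝕜 := ℂ) (star c) (ξ x)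

/-- The sequence of powers of a point of the open unit disc. -/
def powSeq (hz : ‖z‖ < 1) : L2N :=
  ⟨fun n => z ^ n, memℓp_gen <| by
    have hsum := summable_geometric_of_lt_one (sq_nonneg ‖z‖)
      (pow_lt_one₀ (norm_nonneg z) hz two_ne_zero)
    refine hsum.congr fun n => ?_
    rw [norm_pow, ENNReal.toReal_ofNat, Real.rpow_ofNat, pow_right_comm]⟩

/-- The functional `ξ ↦ ∑ zⁿ ξ(x)(n)`. -/
def powFunctional (x : X) (hz : ‖z‖ < 1) : HilbertSum X →L[ℂ] ℂ :=
  rowFunctional x (powSeq hz)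

/-- The functional `ξ ↦ ∑ zⁿ ξ(x)(n + 1)`. -/
def tailFunctional (x : X) (hz : ‖z‖ < 1) : HilbertSum X →L[ℂ] ℂ :=
  rowFunctional x (shift (powSeq hz))

theorem hasSum_powFunctional (x : X) (hz : ‖z‖ < 1) (ξ : HilbertSum X) :
    HasSum (fun n => z ^ n * ξ x n) (powFunctional x hz ξ) :=
  hasSum_rowFunctional x (powSeq hz) ξ

theorem hasSum_tailFunctional (x : X) (hz : ‖z‖ < 1) (ξ : HilbertSum X) :
    HasSum (fun n => z ^ n * ξ x (n + 1)) (tailFunctional x hz ξ) := by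
  have hhead : ∑ n ∈ Finset.range 1, shift (powSeq hz) n * ξ x n = 0 :=
    (Finset.sum_range_one _).trans (zero_mul _)
  have h := (hasSum_nat_add_iff' 1).2 (hasSum_rowFunctional x (shift (powSeq hz)) ξ)
  rwa [hhead, sub_zero] at h

theorem powFunctional_eq_add (x : X) (hz : ‖z‖ < 1) (ξ : HilbertSum X) :
    powFunctional x hz ξ = ξ x 0 + z * tailFunctional x hz ξ := by
  have h := (hasSum_nat_add_iff' 1).2 (hasSum_powFunctional x hz ξ)
  rw [Finset.sum_range_one, pow_zero, one_mul] at h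
  refine sub_eq_iff_eq_add'.1 (h.unique ?_)
  simpa only [pow_succ', mul_assoc] using (hasSum_tailFunctional x hz ξ).mul_left z

theorem tailFunctional_sumShift (x : X) (hz : ‖z‖ < 1) (ξ : HilbertSum X) :
    tailFunctional x hz (sumShift ξ) = powFunctional x hz ξ :=
  (hasSum_tailFunctional x hz _).unique (hasSum_powFunctional x hz ξ)

theorem powFunctional_sumShift (x : X) (hz : ‖z‖ < 1) (ξ : HilbertSum X) :
    powFunctional x hz (sumShift ξ) = z * powFunctional x hz ξ := by
  rw [powFunctional_eq_add, tailFunctional_sumShift, sumShift_apply_zero, zero_add]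

theorem tailFunctional_vacuum (x : X) (hz : ‖z‖ < 1) : tailFunctional x hz (vacuum x) = 0 := by
  refine (hasSum_tailFunctional x hz _).unique ?_
  simp only [vacuum_apply_succ, mul_zero, hasSum_zero]

theorem powFunctional_vacuum (x : X) (hz : ‖z‖ < 1) : powFunctional x hz (vacuum x) = 1 := by
  rw [powFunctional_eq_add, tailFunctional_vacuum, vacuum_apply_zero, mul_zero, add_zero]

theorem differentiableOn_tsum_pow (x : X) (ξ : HilbertSum X) :
    DifferentiableOn ℂ (fun z => ∑' n, z ^ n * ξ x n) (Metric.ball 0 1) := by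
  intro z hz
  obtain ⟨r, hzr, hr⟩ := exists_between (mem_ball_zero_iff.1 hz)
  have hsum : Summable fun n => r ^ n * ‖ξ‖ :=
    (summable_geometric_of_lt_one ((norm_nonneg z).trans hzr.le) hr).mul_right ‖ξ‖
  have hdiff := Complex.differentiableOn_tsum_of_summable_norm
    (F := fun n z => z ^ n * ξ x n) hsum (fun n => by fun_prop) Metric.isOpen_ball
    fun n w (hw : w ∈ Metric.ball 0 r) => by
      have hpow : ‖w ^ n‖ ≤ r ^ n := norm_pow w n ▸
        pow_le_pow_left₀ (norm_nonneg w) (mem_ball_zero_iff.1 hw).le n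
      exact norm_mul_le_of_le hpow (norm_apply_apply_le ξ x n)
  exact (hdiff.differentiableAt
    (Metric.isOpen_ball.mem_nhds (mem_ball_zero_iff.2 hzr))).differentiableWithinAt

end Functionals

section DiskCharacters

variable {X : Type*} {η : X → X} {x : X} {z : ℂ}

/-- The coordinates `(x, z)`, with `z` in the open unit disc, of a character `f ↦ f x`,
`U g ↦ z g(x)` of the semicrossed product: away from the fixed points of `η` only `z = 0` occurs. -/
structure IsDiskPoint (η : X → X) (x : X) (z : ℂ) : Prop where
  norm_lt_one : ‖z‖ < 1
  eq_zero_or_fixed : z = 0 ∨ η x = x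

theorem IsDiskPoint.zero (η : X → X) (x : X) : IsDiskPoint η x 0 :=
  ⟨norm_zero.trans_lt one_pos, Or.inl rfl⟩

theorem IsDiskPoint.of_fixed (hx : η x = x) (hz : ‖z‖ < 1) : IsDiskPoint η x z :=
  ⟨hz, Or.inr hx⟩

theorem exists_isDiskPoint_ne_zero (hx : η x = x) : ∃ z, IsDiskPoint η x z ∧ z ≠ 0 :=
  ⟨1 / 2, .of_fixed hx (by norm_num), by norm_num⟩

theorem IsDiskPoint.pow_mul_apply_iterate (h : IsDiskPoint η x z) (f : X → ℂ) (n : ℕ) :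
    z ^ n * f (η^[n] x) = z ^ n * f x := by
  rcases h.eq_zero_or_fixed with rfl | hx
  · cases n with
    | zero => rfl
    | succ n => rw [zero_pow n.succ_ne_zero, zero_mul, zero_mul]
  · rw [Function.iterate_fixed hx]

variable [TopologicalSpace X]

/-- The multiplicative linear functionals on the semicrossed product. Neither continuity nor
nonvanishing is part of the definition. -/
abbrev Character (η : X → X) : Type _ := semicrossedProduct η →ₙₐ[ℂ] ℂ

theorem Character.norm_apply_le (χ : Character η) (a : semicrossedProduct η) : ‖χ a‖ ≤ ‖a‖ :=
  norm_character_apply_le (𝕜 := ℂ) (A := semicrossedProduct η) χ a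

theorem Character.continuous (χ : Character η) : Continuous χ :=
  continuous_character (𝕜 := ℂ) (A := semicrossedProduct η) χ

theorem powFunctional_sumRep (h : IsDiskPoint η x z) (f : C₀(X, ℂ)) (ξ : HilbertSum X) :
    powFunctional x h.norm_lt_one (sumRep η f ξ) = f x * powFunctional x h.norm_lt_one ξ := by
  have hterm : (fun n => z ^ n * sumRep η f ξ x n) = fun n => f x * (z ^ n * ξ x n) := by
    funext n
    rw [sumRep_apply, ← mul_assoc, h.pow_mul_apply_iterate f, mul_assoc, mul_left_comm]
  have hsum := hasSum_powFunctional x h.norm_lt_one (sumRep η f ξ)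
  rw [hterm] at hsum
  exact hsum.unique ((hasSum_powFunctional x h.norm_lt_one ξ).mul_left (f x))

theorem powFunctional_sumShiftRep (h : IsDiskPoint η x z) (g : C₀(X, ℂ)) (ξ : HilbertSum X) :
    powFunctional x h.norm_lt_one (sumShiftRep η g ξ) =
      z * g x * powFunctional x h.norm_lt_one ξ := by
  change powFunctional x h.norm_lt_one (sumShift (sumRep η g ξ)) = _
  rw [powFunctional_sumShift, powFunctional_sumRep h, mul_assoc]

theorem tailFunctional_sumRep (h : IsDiskPoint η (η x) z) (f : C₀(X, ℂ)) (ξ : HilbertSum X) :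
    tailFunctional x h.norm_lt_one (sumRep η f ξ) =
      f (η x) * tailFunctional x h.norm_lt_one ξ := by
  have hterm : (fun n => z ^ n * sumRep η f ξ x (n + 1)) =
      fun n => f (η x) * (z ^ n * ξ x (n + 1)) := by
    funext n
    rw [sumRep_apply, Function.iterate_succ_apply, ← mul_assoc, h.pow_mul_apply_iterate f,
      mul_assoc, mul_left_comm]
  have hsum := hasSum_tailFunctional x h.norm_lt_one (sumRep η f ξ)
  rw [hterm] at hsum
  exact hsum.unique ((hasSum_tailFunctional x h.norm_lt_one ξ).mul_left (f (η x)))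

theorem tailFunctional_sumShiftRep (h : IsDiskPoint η (η x) z) (g : C₀(X, ℂ))
    (ξ : HilbertSum X) :
    tailFunctional x h.norm_lt_one (sumShiftRep η g ξ) =
      g x * ξ x 0 + z * g (η x) * tailFunctional x h.norm_lt_one ξ := by
  change tailFunctional x h.norm_lt_one (sumShift (sumRep η g ξ)) = _
  rw [tailFunctional_sumShift, powFunctional_eq_add, tailFunctional_sumRep h, sumRep_apply,
    Function.iterate_zero_apply, mul_assoc]

theorem powFunctional_apply (h : IsDiskPoint η x z) (a : semicrossedProduct η)
    (ξ : HilbertSum X) :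
    powFunctional x h.norm_lt_one ((a : HilbertOp X) ξ) =
      powFunctional x h.norm_lt_one ((a : HilbertOp X) (vacuum x)) *
        powFunctional x h.norm_lt_one ξ := by
  induction a using semicrossedProduct_induction generalizing ξ with
  | hp =>
    simp only [Set.ofPred_forall]
    exact isClosed_iInter fun ξ => isClosed_eq (by fun_prop) (by fun_prop)
  | hdiag f =>
    change powFunctional x _ (sumRep η f ξ) = powFunctional x _ (sumRep η f _) * _
    rw [powFunctional_sumRep h, powFunctional_sumRep h, powFunctional_vacuum, mul_one]
  | hshift g =>
    change powFunctional x _ (sumShiftRep η g ξ) = powFunctional x _ (sumShiftRep η g _) * _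
    rw [powFunctional_sumShiftRep h, powFunctional_sumShiftRep h, powFunctional_vacuum, mul_one]
  | hadd a b ha hb =>
    change powFunctional x _ ((a : HilbertOp X) ξ + (b : HilbertOp X) ξ) =
      powFunctional x _ ((a : HilbertOp X) _ + (b : HilbertOp X) _) * _
    rw [map_add, map_add, ha, hb, add_mul]
  | hsmul c a ha =>
    change powFunctional x _ (c • (a : HilbertOp X) ξ) =
      powFunctional x _ (c • (a : HilbertOp X) _) * _
    rw [map_smul, map_smul, ha, smul_mul_assoc]
  | hmul a b ha hb =>
    change powFunctional x _ ((a : HilbertOp X) ((b : HilbertOp X) ξ)) =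
      powFunctional x _ ((a : HilbertOp X) ((b : HilbertOp X) _)) * _
    rw [ha, hb, ha ((b : HilbertOp X) _), mul_assoc]

/-- The character of the semicrossed product with `f ↦ f x` and `U g ↦ z g(x)`. -/
def diskCharacter (h : IsDiskPoint η x z) : Character η where
  toFun a := powFunctional x h.norm_lt_one ((a : HilbertOp X) (vacuum x))
  map_smul' c a := map_smul (powFunctional x h.norm_lt_one) c ((a : HilbertOp X) (vacuum x))
  map_zero' := map_zero (powFunctional x h.norm_lt_one)
  map_add' a b := map_add (powFunctional x h.norm_lt_one) ((a : HilbertOp X) (vacuum x))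
    ((b : HilbertOp X) (vacuum x))
  map_mul' a b := powFunctional_apply h a ((b : HilbertOp X) (vacuum x))

theorem diskCharacter_eq_tsum (h : IsDiskPoint η x z) (a : semicrossedProduct η) :
    diskCharacter h a = ∑' n, z ^ n * (a : HilbertOp X) (vacuum x) x n :=
  (hasSum_powFunctional x h.norm_lt_one _).tsum_eq.symm

theorem diskCharacter_diagHom (h : IsDiskPoint η x z) (f : C₀(X, ℂ)) :
    diskCharacter h (diagHom η f) = f x :=
  (powFunctional_sumRep h f _).trans <| by rw [powFunctional_vacuum, mul_one]

theorem diskCharacter_shiftHom (h : IsDiskPoint η x z) (g : C₀(X, ℂ)) :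
    diskCharacter h (shiftHom η g) = z * g x :=
  (powFunctional_sumShiftRep h g _).trans <| by rw [powFunctional_vacuum, mul_one]

/-- The character of the semicrossed product given by the diagonal coefficient at `x`. -/
abbrev zeroCharacter (η : X → X) (x : X) : Character η :=
  diskCharacter (.zero η x)

theorem zeroCharacter_apply (η : X → X) (x : X) (a : semicrossedProduct η) :
    zeroCharacter η x a = (a : HilbertOp X) (vacuum x) x 0 :=
  (powFunctional_eq_add x _ _).trans <| by rw [zero_mul, add_zero]

theorem apply_apply_zero (a : semicrossedProduct η) (ξ : HilbertSum X) (x : X) :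
    (a : HilbertOp X) ξ x 0 = zeroCharacter η x a * ξ x 0 := by
  have h := powFunctional_apply (.zero η x) a ξ
  rwa [powFunctional_eq_add x _ ξ, powFunctional_eq_add, zero_mul, zero_mul, add_zero,
    add_zero] at h

theorem continuous_zeroCharacter_apply (hη : IsProperMap η) (a : semicrossedProduct η) :
    Continuous fun x => zeroCharacter η x a := by
  obtain ⟨q, hq⟩ := exists_diagAddShift_eq hη a
  refine q.1.continuous.congr fun x => ?_
  rw [zeroCharacter_apply, ← hq, diagAddShift_vacuum]
  rfl

theorem diskCharacter_eq_of_norm_le {x : X} (hx : η x = x) (a : semicrossedProduct η)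
    (hle : ∀ (w : ℂ) (hw : ‖w‖ < 1),
      ‖diskCharacter (.of_fixed hx hw) a‖ ≤ ‖zeroCharacter η x a‖) (hz : ‖z‖ < 1) :
    diskCharacter (.of_fixed hx hz) a = zeroCharacter η x a := by
  simp only [diskCharacter_eq_tsum] at hle ⊢
  exact Complex.eqOn_of_isPreconnected_of_isMaxOn_norm (convex_ball (0 : ℂ) 1).isPreconnected
    Metric.isOpen_ball (differentiableOn_tsum_pow x ((a : HilbertOp X) (vacuum x)))
    (Metric.mem_ball_self one_pos) (fun w hw => hle w (mem_ball_zero_iff.1 hw))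
    (mem_ball_zero_iff.2 hz)

/-- The map `a ↦ ∑ zⁿ a_{n+1}(x)` in terms of the Fourier coefficients of `a = ∑ Uⁿ aₙ`. It is a
derivation over the characters with coordinates `(x, 0)` and `(η x, z)`. -/
def tailDerivation (h : IsDiskPoint η (η x) z) : semicrossedProduct η →ₗ[ℂ] ℂ where
  toFun a := tailFunctional x h.norm_lt_one ((a : HilbertOp X) (vacuum x))
  map_smul' c a := map_smul (tailFunctional x h.norm_lt_one) c ((a : HilbertOp X) (vacuum x))
  map_add' a b := map_add (tailFunctional x h.norm_lt_one) ((a : HilbertOp X) (vacuum x))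
    ((b : HilbertOp X) (vacuum x))

theorem tailDerivation_diagHom (h : IsDiskPoint η (η x) z) (f : C₀(X, ℂ)) :
    tailDerivation h (diagHom η f) = 0 :=
  (tailFunctional_sumRep h f _).trans <| by rw [tailFunctional_vacuum, mul_zero]

theorem tailDerivation_shiftHom (h : IsDiskPoint η (η x) z) (g : C₀(X, ℂ)) :
    tailDerivation h (shiftHom η g) = g x :=
  (tailFunctional_sumShiftRep h g _).trans <| by
    rw [tailFunctional_vacuum, vacuum_apply_zero, mul_zero, mul_one, add_zero]

theorem tailFunctional_apply (h : IsDiskPoint η (η x) z) (a : semicrossedProduct η)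
    (ξ : HilbertSum X) :
    tailFunctional x h.norm_lt_one ((a : HilbertOp X) ξ) =
      tailDerivation h a * ξ x 0 + diskCharacter h a * tailFunctional x h.norm_lt_one ξ := by
  induction a using semicrossedProduct_induction generalizing ξ with
  | hp =>
    have hT (ξ : HilbertSum X) : Continuous fun a : semicrossedProduct η =>
        tailFunctional x h.norm_lt_one ((a : HilbertOp X) ξ) := by fun_prop
    have hD : Continuous (tailDerivation h) := hT (vacuum x)
    have hχ : Continuous (diskCharacter h) := Character.continuous (diskCharacter h)
    simp only [Set.ofPred_forall]
    exact isClosed_iInter fun ξ => isClosed_eq (hT ξ) <|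
      (hD.mul continuous_const).add (hχ.mul continuous_const)
  | hdiag f =>
    rw [tailDerivation_diagHom, diskCharacter_diagHom, zero_mul, zero_add]
    exact tailFunctional_sumRep h f ξ
  | hshift g =>
    rw [tailDerivation_shiftHom, diskCharacter_shiftHom]
    exact tailFunctional_sumShiftRep h g ξ
  | hadd a b ha hb =>
    change tailFunctional x _ ((a : HilbertOp X) ξ + (b : HilbertOp X) ξ) = _
    rw [map_add, map_add, map_add, ha, hb]
    ring
  | hsmul c a ha =>
    change tailFunctional x _ (c • (a : HilbertOp X) ξ) = _
    rw [map_smul, map_smul, map_smul, ha, smul_add, smul_mul_assoc, smul_mul_assoc]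
  | hmul a b ha hb =>
    have hD : tailDerivation h (a * b) = tailDerivation h a * (b : HilbertOp X) (vacuum x) x 0 +
        diskCharacter h a * tailDerivation h b := ha ((b : HilbertOp X) (vacuum x))
    change tailFunctional x _ ((a : HilbertOp X) ((b : HilbertOp X) ξ)) = _
    rw [hD, ← zeroCharacter_apply, ha, hb, map_mul, apply_apply_zero b]
    ring

theorem isPointDerivation_tailDerivation (h : IsDiskPoint η (η x) z) :
    IsPointDerivation (diskCharacter h) (zeroCharacter η x) (tailDerivation h) := fun a b => by
  rw [zeroCharacter_apply]
  exact tailFunctional_apply h a ((b : HilbertOp X) (vacuum x))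

end DiskCharacters

section Coordinates

variable {X : Type*} [TopologicalSpace X] {η : X → X} {χ χ' : Character η} {x x' : X} {w w' z : ℂ}

/-- The character `χ` has coordinates `(x, w)`: on the generators it is `f ↦ f x` and
`U g ↦ w g(x)`. -/
structure HasCoords (χ : Character η) (x : X) (w : ℂ) : Prop where
  apply_diagHom : ∀ f, χ (diagHom η f) = f x
  apply_shiftHom : ∀ g, χ (shiftHom η g) = w * g x

theorem hasCoords_diskCharacter (h : IsDiskPoint η x z) : HasCoords (diskCharacter h) x z :=
  ⟨diskCharacter_diagHom h, diskCharacter_shiftHom h⟩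

theorem hasCoords_zeroCharacter (η : X → X) (x : X) : HasCoords (zeroCharacter η x) x 0 :=
  hasCoords_diskCharacter _

theorem HasCoords.char_eq (h : HasCoords χ x w) (h' : HasCoords χ' x w) : χ = χ' :=
  eq_of_apply_diagHom_eq_of_apply_shiftHom_eq χ.continuous χ'.continuous
    (fun f => (h.apply_diagHom f).trans (h'.apply_diagHom f).symm)
    fun g => (h.apply_shiftHom g).trans (h'.apply_shiftHom g).symm

theorem equicontinuous_character {ι : Type*} (χ : ι → Character η) :
    Equicontinuous fun i => ⇑(χ i) :=
  (LipschitzWith.uniformEquicontinuous (fun i => ⇑(χ i)) 1 fun i =>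
    LipschitzWith.of_dist_le_mul fun a b => by
      rw [dist_eq_norm, dist_eq_norm, ← map_sub, NNReal.coe_one, one_mul]
      exact (χ i).norm_apply_le (a - b)).equicontinuous

theorem HasCoords.tendsto_diskCharacter {ι : Type*} {l : Filter ι} {z : ι → ℂ}
    (h : HasCoords χ x w) (hz : ∀ i, IsDiskPoint η x (z i)) (hzw : Tendsto z l (𝓝 w))
    (a : semicrossedProduct η) : Tendsto (fun i => diskCharacter (hz i) a) l (𝓝 (χ a)) := by
  induction a using semicrossedProduct_induction with
  | hp =>
    exact (equicontinuous_character fun i => diskCharacter (hz i)).isClosed_setOfPred_tendsto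
      χ.continuous
  | hdiag f =>
    simp only [diskCharacter_diagHom, h.apply_diagHom, tendsto_const_nhds]
  | hshift g =>
    simp only [diskCharacter_shiftHom, h.apply_shiftHom]
    exact hzw.mul_const (g x)
  | hadd a b ha hb =>
    simp only [map_add]
    exact ha.add hb
  | hsmul c a ha =>
    simp only [map_smul]
    exact ha.const_smul c
  | hmul a b ha hb =>
    simp only [map_mul]
    exact ha.mul hb

/- `U g` is close to `U (g - k g)` for some `k`, and `χ` does not separate the two. -/
theorem character_comp_diagHom_ne_zero (hχ : χ ≠ 0) : χ.comp (diagHom η) ≠ 0 := by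
  contrapose! hχ
  have hdiag : ∀ f, χ (diagHom η f) = 0 := DFunLike.congr_fun hχ
  refine eq_of_apply_diagHom_eq_of_apply_shiftHom_eq χ.continuous continuous_zero hdiag fun g => ?_
  refine norm_le_zero_iff.1 (le_of_forall_gt_imp_ge_of_dense fun δ hδ => ?_)
  obtain ⟨k, hk⟩ := exists_norm_sub_mul_self_le g hδ
  calc ‖χ (shiftHom η g)‖ = ‖χ (shiftHom η (g - k * g))‖ := by
        rw [mul_comm k, map_sub, ← shiftHom_mul_diagHom, map_sub, map_mul, hdiag, mul_zero,
          sub_zero]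
    _ ≤ ‖shiftHom η (g - k * g)‖ := χ.norm_apply_le _
    _ ≤ δ := (norm_shiftHom_le η _).trans hk

variable [LocallyCompactSpace X] [T2Space X]

theorem exists_hasCoords (hχ : χ ≠ 0) : ∃ x w, HasCoords χ x w := by
  obtain ⟨x, hx⟩ := exists_eq_eval_of_character (character_comp_diagHom_ne_zero hχ)
  have hdiag : ∀ f, χ (diagHom η f) = f x := hx
  obtain ⟨k, hk, -⟩ := exists_zeroAtInfty_apply_eq_one ℂ x
  refine ⟨x, χ (shiftHom η k), hdiag, fun g => ?_⟩
  rw [← hdiag g, ← map_mul, shiftHom_mul_diagHom, mul_comm, ← shiftHom_mul_diagHom, map_mul,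
    hdiag, hk, mul_one]

theorem HasCoords.ne_zero (h : HasCoords χ x w) : χ ≠ 0 := by
  obtain ⟨f, hf, -⟩ := exists_zeroAtInfty_apply_eq_one ℂ x
  rintro rfl
  exact zero_ne_one ((h.apply_diagHom f).trans hf)

theorem HasCoords.unique (h : HasCoords χ x w) (h' : HasCoords χ x' w') : x = x' ∧ w = w' := by
  obtain rfl : x = x' := eq_of_zeroAtInfty_apply_eq fun f =>
    (h.apply_diagHom f).symm.trans (h'.apply_diagHom f)
  obtain ⟨g, hg, -⟩ := exists_zeroAtInfty_apply_eq_one ℂ x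
  have hw := (h.apply_shiftHom g).symm.trans (h'.apply_shiftHom g)
  rw [hg, mul_one, mul_one] at hw
  exact ⟨rfl, hw⟩

theorem HasCoords.norm_le (h : HasCoords χ x w) : ‖w‖ ≤ 1 := by
  obtain ⟨g, hg, hg'⟩ := exists_zeroAtInfty_apply_eq_one ℂ x
  calc ‖w‖ = ‖χ (shiftHom η g)‖ := by rw [h.apply_shiftHom, hg, mul_one]
    _ ≤ ‖shiftHom η g‖ := χ.norm_apply_le _
    _ ≤ 1 := (norm_shiftHom_le η g).trans hg'

theorem HasCoords.fixed (hη : IsProperMap η) (h : HasCoords χ x w) (hw : w ≠ 0) : η x = x := by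
  refine eq_of_zeroAtInfty_apply_eq (𝕜 := ℂ) fun f => ?_
  obtain ⟨g, hg, -⟩ := exists_zeroAtInfty_apply_eq_one ℂ x
  have hcov := congrArg χ (diagHom_mul_shiftHom hη f g)
  rw [map_mul, map_mul, h.apply_diagHom, h.apply_shiftHom, h.apply_diagHom, hg, mul_one,
    pullback_apply, mul_comm] at hcov
  exact (mul_left_cancel₀ hw hcov).symm

end Coordinates

section NonInnerDerivations

variable {X : Type*} [TopologicalSpace X] {η : X → X} {χ χ' : Character η}
  {D : semicrossedProduct η →ₗ[ℂ] ℂ} {p q : X} {v w : ℂ}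

theorem exists_diagHom_mul_eq (hη : IsProperMap η) (k : C₀(X, ℂ)) (a : semicrossedProduct η) :
    ∃ f b, diagHom η k * a = diagHom η f + shiftHom η (pullback hη k) * b := by
  obtain ⟨⟨f, b⟩, hab⟩ := exists_diagAddShift_eq hη a
  refine ⟨k * f, b, Subtype.ext ?_⟩
  change sumRepHom η k * (a : HilbertOp X) =
    sumRepHom η (k * f) + sumShift * sumRepHom η (pullback hη k) * (b : HilbertOp X)
  rw [← hab, diagAddShift_apply, mul_add, map_mul, ← mul_assoc, sumRepHom_mul_sumShift hη]

variable [LocallyCompactSpace X] [T2Space X]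

theorem IsPointDerivation.apply_shiftHom_eq_zero (hη : IsProperMap η)
    (hD : IsPointDerivation χ χ' D) (hq : HasCoords χ q v) (hp : HasCoords χ' p w)
    (hqp : q ≠ η p) (hdiag : ∀ f, D (diagHom η f) = 0) (g : C₀(X, ℂ)) :
    D (shiftHom η g) = 0 := by
  obtain ⟨f, hfq, hfp, -⟩ := exists_zeroAtInfty_separating ℂ hqp
  have hcov := congrArg D (diagHom_mul_shiftHom hη f g)
  rwa [hD, hD, hdiag, hdiag, hq.apply_diagHom, hp.apply_diagHom, pullback_apply, hfq, hfp,
    zero_mul, zero_add, one_mul, mul_zero, mul_zero, add_zero] at hcov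

/- `D` is not assumed continuous; a factorization `k a = f + U (k ∘ η) b` with `k q = 1` replaces
the approximation of `a` by polynomials in the generators. -/
theorem IsPointDerivation.eq_zero (hη : IsProperMap η) (hD : IsPointDerivation χ χ' D)
    (hq : HasCoords χ q 0) (hdiag : ∀ f, D (diagHom η f) = 0)
    (hshift : ∀ g, D (shiftHom η g) = 0) : D = 0 := by
  refine LinearMap.ext fun a => ?_
  obtain ⟨k, hk, -⟩ := exists_zeroAtInfty_apply_eq_one ℂ q
  obtain ⟨f, b, hka⟩ := exists_diagHom_mul_eq hη k a
  have h := congrArg D hka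
  rwa [hD, map_add, hD, hdiag, hdiag, hshift, hq.apply_diagHom, hq.apply_shiftHom, hk, zero_mul,
    zero_mul, zero_mul, zero_mul, zero_add, zero_add, zero_add, one_mul] at h

theorem IsPointDerivation.eq_of_not_inner (hη : IsProperMap η) (hD : IsPointDerivation χ χ' D)
    (hq : HasCoords χ q 0) (hp : HasCoords χ' p w) (hpq : p ≠ q)
    (hinner : ∀ c, D ≠ innerPointDerivation χ χ' c) : q = η p := by
  obtain ⟨u, hup, huq, -⟩ := exists_zeroAtInfty_separating ℂ hpq
  by_contra hqp
  refine hinner (D (diagHom η u)) (sub_eq_zero.1 ?_)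
  have hE := hD.sub (isPointDerivation_innerPointDerivation χ χ' (D (diagHom η u)))
  have hdiag (f : C₀(X, ℂ)) :
      (D - innerPointDerivation χ χ' (D (diagHom η u))) (diagHom η f) = 0 :=
    sub_eq_zero.2 <| hD.apply_eq_of_commute ((Commute.all f u).map (diagHom η))
      ((hq.apply_diagHom u).trans huq) ((hp.apply_diagHom u).trans hup)
  exact hE.eq_zero hη hq hdiag (hE.apply_shiftHom_eq_zero hη hq hp hqp hdiag)

theorem tailDerivation_ne_innerPointDerivation {x : X} {z : ℂ} (hx : η x ≠ x)
    (h : IsDiskPoint η (η x) z) (c : ℂ) :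
    tailDerivation h ≠ innerPointDerivation (diskCharacter h) (zeroCharacter η x) c := by
  intro heq
  obtain ⟨f, hfx, hfηx, -⟩ := exists_zeroAtInfty_separating ℂ hx.symm
  have hdiag := LinearMap.congr_fun heq (diagHom η f)
  have hshift := LinearMap.congr_fun heq (shiftHom η f)
  rw [innerPointDerivation_apply] at hdiag hshift
  rw [tailDerivation_diagHom, diskCharacter_diagHom, diskCharacter_diagHom, hfx, hfηx, sub_zero,
    mul_one] at hdiag
  rw [tailDerivation_shiftHom, hdiag.symm, zero_mul, hfx] at hshift
  exact one_ne_zero hshift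

end NonInnerDerivations

section PointMap

theorem comp_right_cancel_of_surjective {𝕜 A B C : Type*} [Semiring 𝕜]
    [NonUnitalNonAssocSemiring A] [DistribMulAction 𝕜 A] [NonUnitalNonAssocSemiring B]
    [DistribMulAction 𝕜 B] [NonUnitalNonAssocSemiring C] [DistribMulAction 𝕜 C] {φ : A →ₙₐ[𝕜] B}
    (hφ : Function.Surjective φ) {χ χ' : B →ₙₐ[𝕜] C} (h : χ.comp φ = χ'.comp φ) : χ = χ' :=
  DFunLike.ext' (hφ.injective_comp_right (congrArg DFunLike.coe h))

variable {X Y : Type*} [TopologicalSpace X] [TopologicalSpace Y] [LocallyCompactSpace Y]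
  [T2Space Y] {η : X → X} {θ : Y → Y} {φ : semicrossedProduct η →ₙₐ[ℂ] semicrossedProduct θ}

theorem zeroCharacter_comp_ne_diskCharacter_comp (hφ : Function.Surjective φ) {y : Y} {z : ℂ}
    (h : IsDiskPoint θ y z) (hz : z ≠ 0) :
    (zeroCharacter θ y).comp φ ≠ (diskCharacter h).comp φ := fun heq => by
  have hχ : zeroCharacter θ y = diskCharacter h := comp_right_cancel_of_surjective hφ heq
  have h0 := hasCoords_zeroCharacter θ y
  rw [hχ] at h0
  exact hz ((hasCoords_diskCharacter h).unique h0).2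

variable [LocallyCompactSpace X] [T2Space X]
  {ψ : semicrossedProduct θ →ₙₐ[ℂ] semicrossedProduct η}

theorem exists_hasCoords_comp (hφ : Function.Surjective φ) {χ : Character θ} {y : Y} {v : ℂ}
    (hχ : HasCoords χ y v) : ∃ x w, HasCoords (χ.comp φ) x w :=
  exists_hasCoords fun h => hχ.ne_zero (comp_right_cancel_of_surjective hφ h)

/-- The map of the base spaces induced by a surjective homomorphism `φ` of semicrossed products:
it sends `y` to the base point of the pullback under `φ` of the character with coordinates
`(y, 0)`. -/
def pointMap (hφ : Function.Surjective φ) (y : Y) : X :=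
  (exists_hasCoords_comp hφ (hasCoords_zeroCharacter θ y)).choose

theorem exists_hasCoords_zeroCharacter_comp (hφ : Function.Surjective φ) (y : Y) :
    ∃ w, HasCoords ((zeroCharacter θ y).comp φ) (pointMap hφ y) w :=
  (exists_hasCoords_comp hφ (hasCoords_zeroCharacter θ y)).choose_spec

theorem continuous_pointMap (hφ : Function.Surjective φ) (hθ : IsProperMap θ) :
    Continuous (pointMap hφ) :=
  continuous_of_zeroAtInfty_comp (𝕜 := ℂ) fun f =>
    (continuous_zeroCharacter_apply hθ (φ (diagHom η f))).congr fun y =>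
      (exists_hasCoords_zeroCharacter_comp hφ y).choose_spec.apply_diagHom f

/- A function separating the base points of the pullbacks of `(y, 0)` and `(y, z)` would violate the
maximum modulus principle on the disc over `y`. -/
theorem exists_hasCoords_diskCharacter_comp (hφ : Function.Surjective φ) {y : Y} {z : ℂ}
    (h : IsDiskPoint θ y z) : ∃ w, HasCoords ((diskCharacter h).comp φ) (pointMap hφ y) w := by
  obtain ⟨w₀, hw₀⟩ := exists_hasCoords_zeroCharacter_comp hφ y
  obtain rfl | hy := h.eq_zero_or_fixed
  · exact ⟨w₀, hw₀⟩
  obtain ⟨x, w, hw⟩ := exists_hasCoords_comp hφ (hasCoords_diskCharacter h)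
  suffices hx : x = pointMap hφ y from ⟨w, hx ▸ hw⟩
  by_contra hne
  obtain ⟨f, hf₀, hfx, hf⟩ := exists_zeroAtInfty_separating ℂ (Ne.symm hne)
  have hval₀ : zeroCharacter θ y (φ (diagHom η f)) = 1 := (hw₀.apply_diagHom f).trans hf₀
  have hval : diskCharacter h (φ (diagHom η f)) = 0 := (hw.apply_diagHom f).trans hfx
  have hmax := diskCharacter_eq_of_norm_le hy (φ (diagHom η f)) (fun z' hz' => by
    obtain ⟨x', w', hw'⟩ :=
      exists_hasCoords_comp hφ (hasCoords_diskCharacter (.of_fixed hy hz'))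
    have hval' : diskCharacter (.of_fixed hy hz') (φ (diagHom η f)) = f x' := hw'.apply_diagHom f
    rw [hval', hval₀, norm_one]
    exact (norm_zeroAtInfty_apply_le f x').trans hf) h.norm_lt_one
  exact zero_ne_one (hval.symm.trans (hmax.trans hval₀))

theorem eq_pointMap (hφ : Function.Surjective φ) (hθ : IsProperMap θ) {χ : Character θ} {y : Y}
    {v : ℂ} (hχ : HasCoords χ y v) {x : X} {w : ℂ} (h : HasCoords (χ.comp φ) x w) :
    x = pointMap hφ y := by
  obtain rfl | hv := eq_or_ne v 0
  · rw [hχ.char_eq (hasCoords_zeroCharacter θ y)] at h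
    exact (h.unique (exists_hasCoords_zeroCharacter_comp hφ y).choose_spec).1
  have hz : ∀ z : Metric.ball (0 : ℂ) 1, IsDiskPoint θ y z := fun z =>
    .of_fixed (hχ.fixed hθ hv) (mem_ball_zero_iff.1 z.2)
  have hne : (comap ((↑) : Metric.ball (0 : ℂ) 1 → ℂ) (𝓝 v)).NeBot := by
    rw [← mem_closure_iff_comap_neBot, closure_ball 0 one_ne_zero]
    exact mem_closedBall_zero_iff.2 hχ.norm_le
  refine eq_of_zeroAtInfty_apply_eq (𝕜 := ℂ) fun f => ?_
  have hlim := hχ.tendsto_diskCharacter hz tendsto_comap (φ (diagHom η f))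
  have hval : χ (φ (diagHom η f)) = f x := h.apply_diagHom f
  have hconst : ∀ z, diskCharacter (hz z) (φ (diagHom η f)) = f (pointMap hφ y) := fun z =>
    (exists_hasCoords_diskCharacter_comp hφ (hz z)).choose_spec.apply_diagHom f
  simp only [hval, hconst] at hlim
  exact tendsto_nhds_unique hlim tendsto_const_nhds

theorem pointMap_pointMap (hφ : Function.Surjective φ) (hψ : Function.Surjective ψ)
    (hη : IsProperMap η) (hφψ : Function.LeftInverse φ ψ) :
    Function.LeftInverse (pointMap hψ) (pointMap hφ) := fun y => by
  obtain ⟨w, hw⟩ := exists_hasCoords_zeroCharacter_comp hφ y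
  have hcomp : ((zeroCharacter θ y).comp φ).comp ψ = zeroCharacter θ y :=
    NonUnitalAlgHom.ext fun b => congrArg (zeroCharacter θ y) (hφψ b)
  exact (eq_pointMap hψ hη hw (hcomp ▸ hasCoords_zeroCharacter θ y)).symm

theorem pointMap_fixed (hφ : Function.Surjective φ) (hη : IsProperMap η) {y : Y}
    (hy : θ y = y) : η (pointMap hφ y) = pointMap hφ y := by
  by_contra hne
  obtain ⟨z, h, hz⟩ := exists_isDiskPoint_ne_zero hy
  obtain ⟨w₀, hw₀⟩ := exists_hasCoords_zeroCharacter_comp hφ y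
  obtain ⟨w, hw⟩ := exists_hasCoords_diskCharacter_comp hφ h
  obtain rfl : w₀ = 0 := by_contra fun h₀ => hne (hw₀.fixed hη h₀)
  obtain rfl : w = 0 := by_contra fun h₀ => hne (hw.fixed hη h₀)
  exact zeroCharacter_comp_ne_diskCharacter_comp hφ h hz (hw₀.char_eq hw)

/- Otherwise `w` has modulus `1`, and the second coordinate of the pullback is constant on the disc
over `y` by the maximum modulus principle. -/
theorem norm_coord_lt_one_of_fixed (hφ : Function.Surjective φ) {y : Y} (hy : θ y = y) {w : ℂ}
    (hw : HasCoords ((zeroCharacter θ y).comp φ) (pointMap hφ y) w) : ‖w‖ < 1 := by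
  refine hw.norm_le.lt_of_ne fun hw1 => ?_
  obtain ⟨z, h, hz⟩ := exists_isDiskPoint_ne_zero hy
  obtain ⟨g, hg, -⟩ := exists_zeroAtInfty_apply_eq_one ℂ (pointMap hφ y)
  have hval {χ : Character θ} {v : ℂ} (hv : HasCoords (χ.comp φ) (pointMap hφ y) v) :
      χ (φ (shiftHom η g)) = v := (hv.apply_shiftHom g).trans (by rw [hg, mul_one])
  have hmax := diskCharacter_eq_of_norm_le hy (φ (shiftHom η g)) (fun z' hz' => by
    obtain ⟨v, hv⟩ := exists_hasCoords_diskCharacter_comp hφ (.of_fixed hy hz')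
    rw [hval hv, hval hw, hw1]
    exact hv.norm_le) h.norm_lt_one
  obtain ⟨v, hv⟩ := exists_hasCoords_diskCharacter_comp hφ h
  obtain rfl : v = w := (hval hv).symm.trans (hmax.trans (hval hw))
  exact zeroCharacter_comp_ne_diskCharacter_comp hφ h hz (hw.char_eq hv)

theorem isDiskPoint_of_hasCoords_comp (hη : IsProperMap η) (hθ : IsProperMap θ)
    (hψ : Function.Surjective ψ) (hφψ : Function.LeftInverse φ ψ) {x : X} {y : Y} {w : ℂ}
    (h : HasCoords ((zeroCharacter θ y).comp φ) x w) : IsDiskPoint η x w := by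
  have hφ : Function.Surjective φ := hφψ.surjective
  obtain rfl := eq_pointMap hφ hθ (hasCoords_zeroCharacter θ y) h
  obtain rfl | hw := eq_or_ne w 0
  · exact .zero η _
  have hx := h.fixed hη hw
  refine .of_fixed hx (norm_coord_lt_one_of_fixed hφ ?_ h)
  simpa only [pointMap_pointMap hφ hψ hη hφψ y] using pointMap_fixed hψ hθ hx

theorem exists_diskCharacter_comp_eq_zeroCharacter (hφ : Function.Surjective φ)
    (hη : IsProperMap η) (hθ : IsProperMap θ) (hφψ : Function.LeftInverse φ ψ)
    (hψφ : Function.LeftInverse ψ φ) (y : Y) : ∃ (z : ℂ) (h : IsDiskPoint θ y z),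
      (diskCharacter h).comp φ = zeroCharacter η (pointMap hφ y) := by
  have hψ : Function.Surjective ψ := hψφ.surjective
  obtain ⟨z, hz⟩ := exists_hasCoords_zeroCharacter_comp hψ (pointMap hφ y)
  rw [pointMap_pointMap hφ hψ hη hφψ] at hz
  have h : IsDiskPoint θ y z := isDiskPoint_of_hasCoords_comp hθ hη hφ hψφ hz
  refine ⟨z, h, ?_⟩
  rw [(hasCoords_diskCharacter h).char_eq hz]
  exact NonUnitalAlgHom.ext fun a => congrArg (zeroCharacter η (pointMap hφ y)) (hψφ a)

theorem pointMap_comm (hφ : Function.Surjective φ) (hη : IsProperMap η) (hθ : IsProperMap θ)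
    (hφψ : Function.LeftInverse φ ψ) (hψφ : Function.LeftInverse ψ φ) (y : Y) :
    pointMap hφ (θ y) = η (pointMap hφ y) := by
  obtain hy | hy := eq_or_ne (θ y) y
  · rw [hy, pointMap_fixed hφ hη hy]
  have hne : pointMap hφ y ≠ pointMap hφ (θ y) :=
    (pointMap_pointMap hφ hψφ.surjective hη hφψ).injective.ne hy.symm
  obtain ⟨z, h, hcomp⟩ := exists_diskCharacter_comp_eq_zeroCharacter hφ hη hθ hφψ hψφ (θ y)
  have hq : HasCoords ((diskCharacter h).comp φ) (pointMap hφ (θ y)) 0 :=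
    hcomp ▸ hasCoords_zeroCharacter η _
  obtain ⟨w, hp⟩ := exists_hasCoords_zeroCharacter_comp hφ y
  refine ((isPointDerivation_tailDerivation h).comp φ).eq_of_not_inner hη hq hp hne fun c heq =>
    tailDerivation_ne_innerPointDerivation hy h c (LinearMap.ext fun b => ?_)
  obtain ⟨a, rfl⟩ := hφ b
  exact LinearMap.congr_fun heq a

theorem conjugate_of_isomorphic (hη : IsProperMap η) (hθ : IsProperMap θ)
    (h : IsomorphicAsAlgebras (semicrossedProduct η) (semicrossedProduct θ)) : Conjugate η θ := by
  obtain ⟨φ, hφ⟩ := h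
  obtain ⟨g, hgφ, hφg⟩ := Function.bijective_iff_has_inverse.1 hφ
  let ψ : semicrossedProduct θ →ₙₐ[ℂ] semicrossedProduct η := NonUnitalAlgHom.inverse φ g hgφ hφg
  have hψφ : Function.LeftInverse ψ φ := hgφ
  have hφψ : Function.LeftInverse φ ψ := hφg
  exact ⟨{  toFun := pointMap hψφ.surjective
            invFun := pointMap hφ.2
            left_inv := pointMap_pointMap hψφ.surjective hφ.2 hθ hψφ
            right_inv := pointMap_pointMap hφ.2 hψφ.surjective hη hφψ
            continuous_toFun := continuous_pointMap hψφ.surjective hη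
            continuous_invFun := continuous_pointMap hφ.2 hθ },
    pointMap_comm hψφ.surjective hθ hη hψφ hφψ⟩

end PointMap

section Reindex

variable {X Y : Type*}

theorem memℓp_comp_equiv {ι κ : Type*} {E : ι → Type*} [∀ i, NormedAddCommGroup (E i)] {p : ℝ≥0∞}
    (hp : 0 < p.toReal) (e : κ ≃ ι) (ξ : lp E p) : Memℓp (fun k => ξ (e k)) p :=
  memℓp_gen ((e.summable_iff (f := fun i => ‖ξ i‖ ^ p.toReal)).2 (lp.hasSum_norm hp ξ).summable)

/-- The unitary `⨁_{x ∈ X} ℓ²(ℕ) ≃ ⨁_{y ∈ Y} ℓ²(ℕ)` relabelling the summands along `e`. -/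
def reindex (e : X ≃ Y) : HilbertSum X ≃ₗᵢ[ℂ] HilbertSum Y where
  toFun ξ := ⟨fun y => ξ (e.symm y), memℓp_comp_equiv (by norm_num) e.symm ξ⟩
  invFun ζ := ⟨fun x => ζ (e x), memℓp_comp_equiv (by norm_num) e ζ⟩
  left_inv ξ := lp.ext <| funext fun x => congrArg ξ (e.symm_apply_apply x)
  right_inv ζ := lp.ext <| funext fun y => congrArg ζ (e.apply_symm_apply y)
  map_add' _ _ := rfl
  map_smul' _ _ := rfl
  norm_map' _ := norm_lp_eq_of_equiv (by norm_num) e.symm fun _ => rfl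

/-- Conjugation of operators by `reindex e`. -/
def reindexConj (e : X ≃ Y) : HilbertOp X ≃A[ℂ] HilbertOp Y :=
  (reindex e).toContinuousLinearEquiv.conjContinuousAlgEquiv

theorem reindexConj_sumShift (e : X ≃ Y) : reindexConj e sumShift = sumShift :=
  hilbertOp_ext fun ζ y n => by
    cases n with
    | zero => rfl
    | succ n => exact congrArg (fun y => ζ y n) (e.apply_symm_apply y)

variable [TopologicalSpace X] [TopologicalSpace Y] {η : X → X} {θ : Y → Y}

theorem reindexConj_sumRepHom (h : X ≃ₜ Y) (hh : Function.Semiconj h η θ) (f : C₀(X, ℂ)) :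
    reindexConj h.toEquiv (sumRepHom η f) = sumRepHom θ (pullback h.symm.isProperMap f) :=
  hilbertOp_ext fun ζ y n => by
    have hiter : η^[n] (h.symm y) = h.symm (θ^[n] y) :=
      h.eq_symm_apply.2 ((hh.iterate_right n (h.symm y)).trans
        (congrArg θ^[n] (h.apply_symm_apply y)))
    have hζ : ζ (h (h.symm y)) n = ζ y n := congrArg (fun y => ζ y n) (h.apply_symm_apply y)
    exact congrArg₂ (· * ·) (congrArg f hiter) hζ

theorem reindexConj_mem (h : X ≃ₜ Y) (hh : Function.Semiconj h η θ) {a : HilbertOp X}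
    (ha : a ∈ semicrossedProduct η) : reindexConj h.toEquiv a ∈ semicrossedProduct θ := by
  suffices hle : semicrossedProduct η ≤
      (semicrossedProduct θ).comap (reindexConj h.toEquiv) from hle ha
  refine semicrossedProduct_le
    ((isClosed_semicrossedProduct θ).preimage (reindexConj h.toEquiv).continuous)
    (fun f => ?_) (fun g => ?_)
  · change reindexConj h.toEquiv (sumRepHom η f) ∈ semicrossedProduct θ
    rw [reindexConj_sumRepHom h hh, ← coe_diagHom]
    exact SetLike.coe_mem _
  · change reindexConj h.toEquiv (sumShift * sumRepHom η g) ∈ semicrossedProduct θ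
    rw [map_mul, reindexConj_sumShift, reindexConj_sumRepHom h hh, ← coe_shiftHom]
    exact SetLike.coe_mem _

theorem isomorphic_of_conjugate (h : Conjugate η θ) :
    IsomorphicAsAlgebras (semicrossedProduct η) (semicrossedProduct θ) := by
  obtain ⟨h, hh⟩ := h
  have hsymm : Function.Semiconj h.symm θ η :=
    Function.Semiconj.inverse_left hh h.symm_apply_apply h.apply_symm_apply
  let φ : semicrossedProduct η →ₙₐ[ℂ] semicrossedProduct θ :=
    NonUnitalAlgHom.codRestrict ((reindexConj h.toEquiv : HilbertOp X →ₙₐ[ℂ] HilbertOp Y).comp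
      (NonUnitalSubalgebraClass.subtype (semicrossedProduct η))) _
      fun a => reindexConj_mem h hh a.2
  refine ⟨φ, fun a b hab => ?_, fun b => ?_⟩
  · exact Subtype.ext ((reindexConj h.toEquiv).injective (congrArg Subtype.val hab))
  · exact ⟨⟨_, reindexConj_mem h.symm hsymm b.2⟩,
      Subtype.ext ((reindexConj h.toEquiv).apply_symm_apply (b : HilbertOp Y))⟩

end Reindex

end Semicrossed

end

theorem mainTheorem2 {X₁ X₂ : Type*}
    [TopologicalSpace X₁] [LocallyCompactSpace X₁] [T2Space X₁]
    [TopologicalSpace X₂] [LocallyCompactSpace X₂] [T2Space X₂]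
    (η₁ : X₁ → X₁) (η₂ : X₂ → X₂) (hη₁ : IsProperMap η₁) (hη₂ : IsProperMap η₂) :
    Semicrossed.Conjugate η₁ η₂ ↔
      Semicrossed.IsomorphicAsAlgebras
        (Semicrossed.semicrossedProduct η₁) (Semicrossed.semicrossedProduct η₂) :=
  ⟨Semicrossed.isomorphic_of_conjugate, Semicrossed.conjugate_of_isomorphic hη₁ hη₂⟩
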